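/- **Theorem (lower bound).** In the problem Delayed Feedback Vertex Set, a finite simple graph $G$ with vertices $v_1,\dots,v_n$ is revealed vertex by vertex, each vertex together with its edges to the earlier vertices. An online algorithm has to select for every $i$, knowing only $G[\{v_1,\dots,v_i\}]$ (and neither $n$ nor the rest of the graph), a set $S_i\subseteq\{v_1,\dots,v_i\}$ such that $S_1\subseteq S_2\subseteq\dots\subseteq S_n$ and the induced subgraph $G[\{v_1,\dots,v_i\}\setminus S_i]$ contains no cycle. Its cost on $G$ is $\mathrm{ALG}(G)=|S_n|$, and $\mathrm{OPT}(G)$ denotes the smallest size of a feedback vertex set of $G$, that is, of a set of vertices whose removal leaves a graph without cycles. Let $\varepsilon>0$. Then no deterministic online algorithm for Delayed Feedback Vertex Set achieves a competitive ratio of $4-\varepsilon$. That is, there is no such algorithm with $\mathrm{ALG}(G)\le(4-\varepsilon)\,\mathrm{OPT}(G)$ for all instances $G$ (strict competitive ratio); nor is there one for which, with some constant $\kappa$ independent of the instance, $\mathrm{ALG}(G)\le(4-\varepsilon)\,\mathrm{OPT}(G)+\kappa$ for all instances $G$ (competitive ratio up to an additive constant). -/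

import Mathlib

namespace DelayedFVS

/-- `S` is a feedback vertex set of `G`: the induced subgraph `G[V ∖ S]` is cycle-free. -/
def IsFeedbackVertexSet {V : Type*} (G : SimpleGraph V) (S : Set V) : Prop :=
  (G.induce Sᶜ).IsAcyclic

/-- The size of a smallest feedback vertex set of a graph on `n` vertices. -/
noncomputable def opt {n : ℕ} (G : SimpleGraph (Fin n)) : ℕ :=
  sInf {k | ∃ S : Finset (Fin n), IsFeedbackVertexSet G (S : Set (Fin n)) ∧ S.card = k}

/-- The minimum in the definition of `opt` is attained. -/
theorem exists_card_eq_opt {n : ℕ} (G : SimpleGraph (Fin n)) :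
    ∃ S : Finset (Fin n), IsFeedbackVertexSet G (S : Set (Fin n)) ∧ S.card = opt G := by
  have h : {k | ∃ S : Finset (Fin n),
      IsFeedbackVertexSet G (S : Set (Fin n)) ∧ S.card = k}.Nonempty := by
    refine ⟨_, Finset.univ, ?_, rfl⟩
    intro v
    exact absurd (Finset.mem_coe.2 (Finset.mem_univ v.1)) v.2
  exact Nat.sInf_mem h

/-- A (deterministic) online algorithm for Delayed Feedback Vertex Set.

An online instance is a finite simple graph whose vertices are numbered `0, 1, …, n - 1` in the
order in which they are revealed, each together with its edges to the earlier vertices. So, when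
`i` vertices have been revealed, what the algorithm has seen is precisely the subgraph induced by
the first `i` vertices, a graph on `Fin i`; `select i H` is the set of vertices deleted by then if
the graph seen is `H`. -/
structure OnlineAlgorithm where
  select : (i : ℕ) → SimpleGraph (Fin i) → Finset (Fin i)
  /-- After every request the remaining graph is cycle-free. -/
  feasible : ∀ (i : ℕ) (H : SimpleGraph (Fin i)),
    IsFeedbackVertexSet H (select i H : Set (Fin i))
  /-- Deletions are irrevocable: whatever was deleted before the last vertex of `H` was revealed
  is still deleted afterwards. -/
  irrevocable : ∀ (i : ℕ) (H : SimpleGraph (Fin (i + 1))) (v : Fin i),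
    v ∈ select i (H.comap Fin.castSucc) → v.castSucc ∈ select (i + 1) H

/-- The cost of the algorithm on the instance `G`: the number of vertices deleted in the end. -/
def OnlineAlgorithm.cost (A : OnlineAlgorithm) {n : ℕ} (G : SimpleGraph (Fin n)) : ℕ :=
  (A.select n G).card

/-- `A` is `c`-competitive: up to an additive constant, which does not depend on the instance, its
cost is at most `c` times the optimum on every instance. -/
def OnlineAlgorithm.IsCompetitive (A : OnlineAlgorithm) (c : ℝ) : Prop :=
  ∃ κ : ℝ, ∀ (n : ℕ) (G : SimpleGraph (Fin n)), (A.cost G : ℝ) ≤ c * (opt G : ℝ) + κ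

/-- `A` is strictly `c`-competitive: no additive constant is allowed. -/
def OnlineAlgorithm.IsStrictlyCompetitive (A : OnlineAlgorithm) (c : ℝ) : Prop :=
  ∀ (n : ℕ) (G : SimpleGraph (Fin n)), (A.cost G : ℝ) ≤ c * (opt G : ℝ)

/-- Being strictly competitive is the stronger property, so refuting the existence of a competitive
algorithm also refutes the existence of a strictly competitive one. -/
theorem OnlineAlgorithm.IsStrictlyCompetitive.isCompetitive {A : OnlineAlgorithm} {c : ℝ}
    (h : A.IsStrictlyCompetitive c) : A.IsCompetitive c :=
  ⟨0, fun n G => by simpa using h n G⟩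

end DelayedFVS

namespace DelayedFVS

/-! The adversary plays rounds in which the algorithm loses four vertices while an offline set `F`
grows by one. Between rounds `F` lacks one last vertex, and there are two disjoint edges each of
whose endpoints could be that vertex.

Closing a cycle through each edge by an ear forces deletions `z₁` and `z₂`. Choose endpoints `x ≠
z₁` of the first edge and `y ≠ z₂` of the second. Many common neighbours of `x` and `y` force the
deletion of one of them, say `y`. The offline set then takes the other one, `x`, and a large fan at
`x` forces the deletion of `x` as well. Now `x` breaks the old cycles and the first ear, so any
remaining cycle runs through the whole second ear and every vertex of that ear breaks it. The ear
has three disjoint edges and `z₂` spoils at most one, so two are left for the next round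
(`AdversaryState.next`).

After `f` rounds there are at least `4 * f + 1` deletions against an optimum of at most `f + 1`.
Upper bounds on the optimum are certified by vertex rankings (`ForestRanking.opt_le`). -/

open Finset

/-! ### Runs of an algorithm on prefixes of a graph on `ℕ` -/

/-- The subgraph of `G` induced by the first `n` vertices. -/
def firstVertices (G : SimpleGraph ℕ) (n : ℕ) : SimpleGraph (Fin n) :=
  G.comap Fin.val

/-- The vertices deleted by `A` once the first `n` vertices of `G` are revealed. -/
def OnlineAlgorithm.deleted (A : OnlineAlgorithm) (G : SimpleGraph ℕ) (n : ℕ) : Finset ℕ :=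
  (A.select n (firstVertices G n)).map Fin.valEmbedding

/-- `G` and `H` induce the same graph on the first `n` vertices. -/
def AgreeBelow (n : ℕ) (G H : SimpleGraph ℕ) : Prop :=
  ∀ u < n, ∀ v < n, G.Adj u v ↔ H.Adj u v

theorem OnlineAlgorithm.mem_deleted {A : OnlineAlgorithm} {G : SimpleGraph ℕ} {n v : ℕ}
    (hv : v < n) : v ∈ A.deleted G n ↔ (⟨v, hv⟩ : Fin n) ∈ A.select n (firstVertices G n) := by
  simp only [deleted, mem_map, Fin.valEmbedding_apply]
  constructor
  · rintro ⟨w, hw, rfl⟩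
    exact hw
  · exact fun h => ⟨_, h, rfl⟩

theorem OnlineAlgorithm.lt_of_mem_deleted {A : OnlineAlgorithm} {G : SimpleGraph ℕ} {n v : ℕ}
    (hv : v ∈ A.deleted G n) : v < n := by
  simp only [deleted, mem_map, Fin.valEmbedding_apply] at hv
  obtain ⟨w, -, rfl⟩ := hv
  exact w.2

theorem OnlineAlgorithm.card_deleted (A : OnlineAlgorithm) (G : SimpleGraph ℕ) (n : ℕ) :
    (A.deleted G n).card = A.cost (firstVertices G n) := by
  simp [deleted, cost]

theorem OnlineAlgorithm.deleted_mono (A : OnlineAlgorithm) (G : SimpleGraph ℕ) :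
    Monotone (A.deleted G) := by
  refine monotone_nat_of_le_succ fun n v hv => ?_
  have hlt := lt_of_mem_deleted hv
  rw [mem_deleted hlt] at hv
  rw [mem_deleted (hlt.trans n.lt_succ_self)]
  exact A.irrevocable n (firstVertices G (n + 1)) ⟨v, hlt⟩ hv

theorem OnlineAlgorithm.deleted_congr (A : OnlineAlgorithm) {G H : SimpleGraph ℕ} {n : ℕ}
    (h : AgreeBelow n G H) : A.deleted G n = A.deleted H n := by
  have : firstVertices G n = firstVertices H n := by
    ext u v
    exact h u u.2 v v.2
  rw [deleted, deleted, this]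

theorem OnlineAlgorithm.deleted_subset (A : OnlineAlgorithm) {G H : SimpleGraph ℕ} {n m : ℕ}
    (h : AgreeBelow n G H) (hnm : n ≤ m) : A.deleted G n ⊆ A.deleted H m := by
  rw [A.deleted_congr h]
  exact A.deleted_mono H hnm

/-- The algorithm deletes a vertex of every closed chain `g 0, …, g k` whose closing edge is not
among the edges of the chain. -/
theorem OnlineAlgorithm.exists_mem_deleted_of_cycle (A : OnlineAlgorithm) {G : SimpleGraph ℕ}
    {n k : ℕ} (g : ℕ → ℕ) (hlt : ∀ i ≤ k, g i < n) (hadj : ∀ i < k, G.Adj (g i) (g (i + 1)))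
    (hclose : G.Adj (g 0) (g k))
    (hne : ∀ i < k, ¬ (g i = g 0 ∧ g (i + 1) = g k) ∧ ¬ (g i = g k ∧ g (i + 1) = g 0)) :
    ∃ i ≤ k, g i ∈ A.deleted G n := by
  by_contra! hcon
  have hac := A.feasible n (firstVertices G n)
  let S : Set (Fin n) := (A.select n (firstVertices G n) : Set (Fin n))ᶜ
  have hS : ∀ i (hi : i ≤ k), (⟨g i, hlt i hi⟩ : Fin n) ∈ S := by
    intro i hi hmem
    exact hcon i hi ((OnlineAlgorithm.mem_deleted (hlt i hi)).2 hmem)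
  let w : ∀ i, i ≤ k → S := fun i hi => ⟨⟨g i, hlt i hi⟩, hS i hi⟩
  let H := (firstVertices G n).induce S
  have hH : H.IsAcyclic := hac
  -- The chain connects the ends of the closing edge without using it, so that edge is not a bridge;
  -- `g` need not be injective.
  have hreach : ∀ i (hi : i ≤ k),
      (H.deleteEdges {s(w 0 (Nat.zero_le k), w k le_rfl)}).Reachable
        (w 0 (Nat.zero_le k)) (w i hi) := by
    intro i
    induction i with
    | zero => exact fun _ => SimpleGraph.Reachable.refl _
    | succ i ih =>
      intro hi
      refine (ih (by omega)).trans (SimpleGraph.Adj.reachable ?_)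
      rw [SimpleGraph.deleteEdges_adj]
      refine ⟨hadj i (by omega), ?_⟩
      have := hne i (by omega)
      simpa [w, Sym2.eq_iff] using this
  have hbr : H.IsBridge s(w 0 (Nat.zero_le k), w k le_rfl) :=
    SimpleGraph.isAcyclic_iff_forall_adj_isBridge.1 hH hclose
  exact SimpleGraph.isBridge_iff.1 hbr (hreach k le_rfl)

/-! ### Rankings as certificates for feedback vertex sets -/

/-- The vertices below `n` outside `F` can be ranked such that each of them has at most one
neighbour of at most its own rank. -/
def ForestRanking (G : SimpleGraph ℕ) (n : ℕ) (F : Finset ℕ) : Prop :=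
  ∃ rank : ℕ → ℕ, ∀ v < n, v ∉ F → ∀ u₁ < n, u₁ ∉ F → ∀ u₂ < n, u₂ ∉ F →
    G.Adj v u₁ → G.Adj v u₂ → rank u₁ ≤ rank v → rank u₂ ≤ rank v → u₁ = u₂

/-- On a cycle, a vertex of maximal rank would have two distinct neighbours of at most its rank. -/
theorem isAcyclic_of_rank {V : Type*} (G : SimpleGraph V) (rank : V → ℕ)
    (h : ∀ v u₁ u₂, G.Adj v u₁ → G.Adj v u₂ → rank u₁ ≤ rank v → rank u₂ ≤ rank v → u₁ = u₂) :
    G.IsAcyclic := by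
  classical
  intro v c hc
  obtain ⟨x, hx, hmax⟩ := c.support.toFinset.exists_max_image rank
    ⟨v, by simp⟩
  simp only [List.mem_toFinset] at hx hmax
  have hc' := hc.rotate hx
  have hmem : ∀ y ∈ (c.rotate x hx).support, rank y ≤ rank x := by
    intro y hy
    refine hmax y ?_
    simpa using hy
  exact hc'.snd_ne_penultimate (h x _ _ ((c.rotate x hx).adj_snd hc'.not_nil)
    ((c.rotate x hx).adj_penultimate hc'.not_nil).symm
    (hmem _ (SimpleGraph.Walk.getVert_mem_support _ _))
    (hmem _ (SimpleGraph.Walk.getVert_mem_support _ _)))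

theorem ForestRanking.opt_le {G : SimpleGraph ℕ} {n : ℕ} {F : Finset ℕ}
    (h : ForestRanking G n F) : opt (firstVertices G n) ≤ F.card := by
  classical
  obtain ⟨rank, hr⟩ := h
  let S : Finset (Fin n) := univ.filter fun v => (v : ℕ) ∈ F
  have hS : IsFeedbackVertexSet (firstVertices G n) (S : Set (Fin n)) := by
    refine isAcyclic_of_rank _ (fun v => rank v.1) ?_
    rintro ⟨v, hv⟩ ⟨u₁, h₁⟩ ⟨u₂, h₂⟩ a₁ a₂ r₁ r₂
    simp only [S, coe_filter, mem_univ, true_and, Set.mem_compl_iff, Set.mem_ofPred_eq] at hv h₁ h₂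
    exact Subtype.ext (Fin.ext (hr v v.2 hv u₁ u₁.2 h₁ u₂ u₂.2 h₂ a₁ a₂ r₁ r₂))
  have hcard : S.card ≤ F.card :=
    card_le_card_of_injOn Fin.val (fun v hv => by simpa [S] using hv)
      Fin.val_injective.injOn
  refine le_trans (Nat.sInf_le ?_) hcard
  exact (⟨S, hS, rfl⟩ : ∃ T : Finset (Fin n),
    IsFeedbackVertexSet (firstVertices G n) (T : Set (Fin n)) ∧ T.card = S.card)

/-- Extending a ranking to new vertices, which are ranked above the old ones by `σ`. -/
theorem ForestRanking.extend {G H : SimpleGraph ℕ} {n m : ℕ} {F F' : Finset ℕ}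
    (h : ForestRanking G n F) (hGH : AgreeBelow n G H) (hF : F ⊆ F') (σ : ℕ → ℕ)
    (hσ : ∀ v < m, n ≤ v → v ∉ F' → ∀ u₁ < m, u₁ ∉ F' → ∀ u₂ < m, u₂ ∉ F' →
      H.Adj v u₁ → H.Adj v u₂ → (n ≤ u₁ → σ u₁ ≤ σ v) → (n ≤ u₂ → σ u₂ ≤ σ v) → u₁ = u₂) :
    ForestRanking H m F' := by
  obtain ⟨rank, hr⟩ := h
  -- Shifting `σ` above all old ranks keeps new vertices out of the condition at old ones.
  have hM : ∀ u < n, rank u < (range n).sup rank + 1 := fun u hu =>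
    Nat.lt_succ_of_le (le_sup (f := rank) (mem_range.2 hu))
  set M := (range n).sup rank + 1
  refine ⟨fun u => if u < n then rank u else M + σ u, ?_⟩
  intro v hv hvF u₁ hu₁ h₁F u₂ hu₂ h₂F a₁ a₂ r₁ r₂
  by_cases hvn : v < n
  · have key : ∀ u, (if u < n then rank u else M + σ u) ≤ (if v < n then rank v else M + σ v) →
        u < n ∧ rank u ≤ rank v := by
      intro u hu
      have := hM v hvn
      split_ifs at hu with h
      · exact ⟨h, hu⟩
      · omega
    obtain ⟨l₁, s₁⟩ := key u₁ r₁
    obtain ⟨l₂, s₂⟩ := key u₂ r₂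
    exact hr v hvn (fun h => hvF (hF h)) u₁ l₁ (fun h => h₁F (hF h)) u₂ l₂ (fun h => h₂F (hF h))
      ((hGH v hvn u₁ l₁).2 a₁) ((hGH v hvn u₂ l₂).2 a₂) s₁ s₂
  · have key : ∀ u, (if u < n then rank u else M + σ u) ≤ (if v < n then rank v else M + σ v) →
        n ≤ u → σ u ≤ σ v := by
      intro u hu hnu
      rw [if_neg hvn, if_neg (by omega)] at hu
      omega
    exact hσ v hv (by omega) hvF u₁ hu₁ h₁F u₂ hu₂ h₂F a₁ a₂ (key u₁ r₁) (key u₂ r₂)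

/-! ### Gadgets: ears, common neighbours, fans -/

/-- The graph obtained from the first `n` vertices of `G` by adding the edges described by `E`. -/
def attach (G : SimpleGraph ℕ) (n : ℕ) (E : ℕ → ℕ → Prop) : SimpleGraph ℕ :=
  SimpleGraph.fromRel fun u v => (u < n ∧ v < n ∧ G.Adj u v) ∨ E u v

theorem attach_adj {G : SimpleGraph ℕ} {n : ℕ} {E : ℕ → ℕ → Prop} {u v : ℕ} :
    (attach G n E).Adj u v ↔
      (u < n ∧ v < n ∧ G.Adj u v) ∨ (u ≠ v ∧ (E u v ∨ E v u)) := by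
  have := G.adj_comm u v
  have h : G.Adj u v → u ≠ v := fun h => h.ne
  rw [attach, SimpleGraph.fromRel_adj]
  tauto

theorem agreeBelow_attach {G : SimpleGraph ℕ} {n : ℕ} {E : ℕ → ℕ → Prop}
    (hE : ∀ u v, E u v → n ≤ u ∨ n ≤ v) : AgreeBelow n G (attach G n E) := by
  intro u hu v hv
  have h₁ := hE u v
  have h₂ := hE v u
  rw [attach_adj]
  constructor
  · exact fun h => Or.inl ⟨hu, hv, h⟩
  · rintro (h | ⟨-, h | h⟩)
    · exact h.2.2
    · have := h₁ h
      omega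
    · have := h₂ h
      omega

/-- A path `n, …, n + 5` of new vertices from `p` to `q`. -/
def earEdges (n p q u v : ℕ) : Prop :=
  (u = p ∧ v = n) ∨ (n ≤ u ∧ u < n + 5 ∧ v = u + 1) ∨ (u = n + 5 ∧ v = q)

/-- `k` new vertices adjacent to `a` and `b`. -/
def commonNeighborEdges (n k a b u v : ℕ) : Prop :=
  (u = a ∨ u = b) ∧ n ≤ v ∧ v < n + k

/-- A path of `k` new vertices, all of them adjacent to `y`. -/
def fanEdges (n k y u v : ℕ) : Prop :=
  n ≤ v ∧ v < n + k ∧ (u = y ∨ (n ≤ u ∧ v = u + 1))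

section ear

variable {G : SimpleGraph ℕ} {n p q : ℕ}

theorem agreeBelow_ear : AgreeBelow n G (attach G n (earEdges n p q)) :=
  agreeBelow_attach fun u v h => by
    unfold earEdges at h
    omega

theorem ear_adj_succ {v : ℕ} (h₁ : n ≤ v) (h₂ : v < n + 5) :
    (attach G n (earEdges n p q)).Adj v (v + 1) :=
  attach_adj.2 (Or.inr ⟨by omega, Or.inl (Or.inr (Or.inl ⟨h₁, h₂, rfl⟩))⟩)

theorem exists_mem_deleted_ear (A : OnlineAlgorithm) (hp : p < n) (hq : q < n)
    (hpq : G.Adj p q) :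
    ∃ z ∈ A.deleted (attach G n (earEdges n p q)) (n + 6), z = p ∨ z = q ∨ n ≤ z := by
  have hne := hpq.ne
  obtain ⟨i, hi, hz⟩ := A.exists_mem_deleted_of_cycle (n := n + 6) (k := 7)
    (G := attach G n (earEdges n p q))
    (fun i => if i = 0 then p else if i = 7 then q else n + i - 1)
    (fun i hi => by split_ifs <;> omega)
    (fun i hi => by
      rw [attach_adj]
      right
      unfold earEdges
      interval_cases i <;> simp <;> omega)
    (attach_adj.2 (Or.inl ⟨hp, hq, hpq⟩))
    (fun i hi => by interval_cases i <;> simp <;> omega)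
  refine ⟨_, hz, ?_⟩
  split_ifs <;> omega

/-- A broken ear falls into paths hanging from `p` and from `q`, along which the ranks increase away
from the attachment. -/
theorem ForestRanking.ear {F F' : Finset ℕ} (h : ForestRanking G n F) (hF : F ⊆ F')
    (hp : p < n) (hq : q < n) (hbreak : p ∈ F' ∨ q ∈ F' ∨ ∃ w ∈ F', n ≤ w ∧ w < n + 6) :
    ForestRanking (attach G n (earEdges n p q)) (n + 6) F' := by
  -- Vertices before the cut `w` hang from `p`, those after it from `q`. If `p` or `q` itself is
  -- removed, `w` lies off the ear and all of it hangs from the other end.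
  obtain ⟨w, hw⟩ : ∃ w, (p ∈ F' ∧ w < n) ∨ (q ∈ F' ∧ n + 6 ≤ w) ∨ (w ∈ F' ∧ n ≤ w ∧ w < n + 6) := by
    rcases hbreak with h | h | ⟨w, h, h'⟩
    · exact ⟨0, Or.inl ⟨h, by omega⟩⟩
    · exact ⟨n + 6, Or.inr (Or.inl ⟨h, le_rfl⟩)⟩
    · exact ⟨w, Or.inr (Or.inr ⟨h, h'⟩)⟩
  refine h.extend agreeBelow_ear hF (fun v => if v < w then v else 2 * (n + 6) - v) ?_
  intro v hv hnv hvF u₁ hu₁ h₁F u₂ hu₂ h₂F a₁ a₂ r₁ r₂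
  have hmem : ∀ x, x ∉ F' → (p ∈ F' → x ≠ p) ∧ (q ∈ F' → x ≠ q) ∧ (w ∈ F' → x ≠ w) :=
    fun x hx => ⟨fun h e => hx (e ▸ h), fun h e => hx (e ▸ h), fun h e => hx (e ▸ h)⟩
  obtain ⟨b₁, b₂, b₃⟩ := hmem v hvF
  obtain ⟨c₁, c₂, c₃⟩ := hmem u₁ h₁F
  obtain ⟨d₁, d₂, d₃⟩ := hmem u₂ h₂F
  rw [attach_adj] at a₁ a₂
  unfold earEdges at a₁ a₂
  have a₁' := a₁.resolve_left (by omega)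
  have a₂' := a₂.resolve_left (by omega)
  clear a₁ a₂
  rcases hw with ⟨hw, hw'⟩ | ⟨hw, hw'⟩ | ⟨hw, hw'⟩
  · have c := c₁ hw
    have d := d₁ hw
    split_ifs at r₁ r₂ <;> omega
  · have c := c₂ hw
    have d := d₂ hw
    split_ifs at r₁ r₂ <;> omega
  · have b := b₃ hw
    have c := c₃ hw
    have d := d₃ hw
    split_ifs at r₁ r₂ <;> omega

end ear

section commonNeighbor

variable {G : SimpleGraph ℕ} {n k a b : ℕ}

theorem agreeBelow_commonNeighbor : AgreeBelow n G (attach G n (commonNeighborEdges n k a b)) :=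
  agreeBelow_attach fun _ _ h => Or.inr h.2.1

theorem commonNeighbor_adj {v : ℕ} (ha : a < n) (h₁ : n ≤ v) (h₂ : v < n + k) :
    (attach G n (commonNeighborEdges n k a b)).Adj a v :=
  attach_adj.2 (Or.inr ⟨by omega, Or.inl ⟨Or.inl rfl, h₁, h₂⟩⟩)

theorem commonNeighbor_adj' {v : ℕ} (hb : b < n) (h₁ : n ≤ v) (h₂ : v < n + k) :
    (attach G n (commonNeighborEdges n k a b)).Adj b v :=
  attach_adj.2 (Or.inr ⟨by omega, Or.inl ⟨Or.inr rfl, h₁, h₂⟩⟩)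

theorem le_card_deleted_commonNeighbor (A : OnlineAlgorithm) (ha : a < n) (hb : b < n)
    (hab : a ≠ b)
    (ha' : a ∉ A.deleted (attach G n (commonNeighborEdges n k a b)) (n + k))
    (hb' : b ∉ A.deleted (attach G n (commonNeighborEdges n k a b)) (n + k)) :
    k ≤ (A.deleted (attach G n (commonNeighborEdges n k a b)) (n + k)).card + 1 := by
  set D := A.deleted (attach G n (commonNeighborEdges n k a b)) (n + k) with hD
  -- Two surviving common neighbours would form a 4-cycle with `a` and `b`.
  have hone : (Ico n (n + k) \ D).card ≤ 1 := by
    rw [card_le_one]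
    intro c hc d hd
    simp only [mem_sdiff, mem_Ico] at hc hd
    by_contra hcd
    obtain ⟨i, hi, hz⟩ := A.exists_mem_deleted_of_cycle (n := n + k) (k := 3)
      (G := attach G n (commonNeighborEdges n k a b))
      (fun i => if i = 0 then a else if i = 1 then c else if i = 2 then b else d)
      (fun i hi => by split_ifs <;> omega)
      (fun i hi => by
        interval_cases i
        · exact commonNeighbor_adj ha hc.1.1 hc.1.2
        · exact (commonNeighbor_adj' hb hc.1.1 hc.1.2).symm
        · exact commonNeighbor_adj' hb hd.1.1 hd.1.2)
      (commonNeighbor_adj ha hd.1.1 hd.1.2)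
      (fun i hi => by interval_cases i <;> simp <;> omega)
    rw [← hD] at hz
    split_ifs at hz
    · exact ha' hz
    · exact hc.2 hz
    · exact hb' hz
    · exact hd.2 hz
  have := card_le_card_sdiff_add_card (s := Ico n (n + k)) (t := D)
  rw [Nat.card_Ico] at this
  omega

theorem ForestRanking.commonNeighbor {F : Finset ℕ} (h : ForestRanking G n F)
    (ha : a < n) (hb : b < n) (hF : a ∈ F ∨ b ∈ F) :
    ForestRanking (attach G n (commonNeighborEdges n k a b)) (n + k) F := by
  refine h.extend agreeBelow_commonNeighbor subset_rfl id ?_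
  intro v hv hnv hvF u₁ hu₁ h₁F u₂ hu₂ h₂F a₁ a₂ r₁ r₂
  have hmem : ∀ x, x ∉ F → (a ∈ F → x ≠ a) ∧ (b ∈ F → x ≠ b) :=
    fun x hx => ⟨fun h e => hx (e ▸ h), fun h e => hx (e ▸ h)⟩
  obtain ⟨c₁, c₂⟩ := hmem u₁ h₁F
  obtain ⟨d₁, d₂⟩ := hmem u₂ h₂F
  rw [attach_adj] at a₁ a₂
  unfold commonNeighborEdges at a₁ a₂
  have a₁' := a₁.resolve_left (by omega)
  have a₂' := a₂.resolve_left (by omega)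
  clear a₁ a₂
  rcases hF with hF | hF <;> simp only [hF, true_imp_iff] at * <;> omega

end commonNeighbor

section fan

variable {G : SimpleGraph ℕ} {n k y : ℕ}

theorem agreeBelow_fan : AgreeBelow n G (attach G n (fanEdges n k y)) :=
  agreeBelow_attach fun _ _ h => Or.inr h.1

theorem fan_adj {v : ℕ} (hy : y < n) (h₁ : n ≤ v) (h₂ : v < n + k) :
    (attach G n (fanEdges n k y)).Adj y v :=
  attach_adj.2 (Or.inr ⟨by omega, Or.inl ⟨h₁, h₂, Or.inl rfl⟩⟩)

theorem le_card_deleted_fan (A : OnlineAlgorithm) (hy : y < n)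
    (hy' : y ∉ A.deleted (attach G n (fanEdges n (2 * k) y)) (n + 2 * k)) :
    k ≤ (A.deleted (attach G n (fanEdges n (2 * k) y)) (n + 2 * k)).card := by
  set D := A.deleted (attach G n (fanEdges n (2 * k) y)) (n + 2 * k) with hD
  -- The fan contains `k` triangles sharing only `y`; `(z - n) / 2` is the index of the triangle
  -- containing `z`.
  have hhit : ∀ j ∈ range k, ∃ z ∈ D, (z - n) / 2 = j := by
    intro j hj
    rw [mem_range] at hj
    obtain ⟨i, hi, hz⟩ := A.exists_mem_deleted_of_cycle (n := n + 2 * k) (k := 2)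
      (G := attach G n (fanEdges n (2 * k) y))
      (fun i => if i = 0 then y else n + 2 * j + i - 1)
      (fun i hi => by split_ifs <;> omega)
      (fun i hi => by
        interval_cases i
        · exact fan_adj hy (by simp) (by simp; omega)
        · refine attach_adj.2 (Or.inr ⟨by simp, Or.inl ⟨?_, ?_, Or.inr ⟨?_, ?_⟩⟩⟩) <;>
            simp <;> omega)
      (fan_adj hy (by simp; omega) (by simp; omega))
      (fun i hi => by interval_cases i <;> simp <;> omega)
    rw [← hD] at hz
    split_ifs at hz with h
    · exact absurd hz hy'
    · exact ⟨_, hz, by omega⟩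
  have hsub : range k ⊆ D.image fun z => (z - n) / 2 := by
    intro j hj
    obtain ⟨z, hz, h⟩ := hhit j hj
    exact mem_image.2 ⟨z, hz, h⟩
  simpa using (card_le_card hsub).trans card_image_le

theorem ForestRanking.fan {F : Finset ℕ} (h : ForestRanking G n F) (hy : y < n) (hF : y ∈ F) :
    ForestRanking (attach G n (fanEdges n k y)) (n + k) F := by
  refine h.extend agreeBelow_fan subset_rfl id ?_
  intro v hv hnv hvF u₁ hu₁ h₁F u₂ hu₂ h₂F a₁ a₂ r₁ r₂
  have hmem : ∀ x, x ∉ F → x ≠ y := fun x hx e => hx (e ▸ hF)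
  have c := hmem u₁ h₁F
  have d := hmem u₂ h₂F
  rw [attach_adj] at a₁ a₂
  unfold fanEdges at a₁ a₂
  simp only [id] at r₁ r₂
  omega

end fan

/-! ### The strategy of the adversary -/

theorem AgreeBelow.trans {n m : ℕ} {G H K : SimpleGraph ℕ} (h : AgreeBelow n G H) (hnm : n ≤ m)
    (h' : AgreeBelow m H K) : AgreeBelow n G K := fun u hu v hv =>
  (h u hu v hv).trans (h' u (hu.trans_le hnm) v (hv.trans_le hnm))

/-- The edge `pq` joins two vertices outside `L` each of which, together with `F`, forms a
feedback vertex set of `G`. -/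
structure CandidateEdge (G : SimpleGraph ℕ) (n : ℕ) (F L : Finset ℕ) (p q : ℕ) : Prop where
  left_lt : p < n
  right_lt : q < n
  adj : G.Adj p q
  left_notMem : p ∉ L
  right_notMem : q ∉ L
  ranking_left : ForestRanking G n (insert p F)
  ranking_right : ForestRanking G n (insert q F)

/-- Against `A`, the adversary has a graph on `n` vertices in which `A` has deleted the vertices
in `L`, and two disjoint candidate edges for `F`. -/
def AdversaryState (A : OnlineAlgorithm) (n : ℕ) (F L : Finset ℕ) : Prop :=
  ∃ (G : SimpleGraph ℕ) (p q r s : ℕ), L ⊆ A.deleted G n ∧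
    CandidateEdge G n F L p q ∧ CandidateEdge G n F L r s ∧ p ≠ r ∧ p ≠ s ∧ q ≠ r ∧ q ≠ s

/-- Of three disjoint edges on an ear, two avoid any given vertex. -/
theorem exists_two_candidateEdges {G : SimpleGraph ℕ} {n m z : ℕ} {F L : Finset ℕ}
    (hm : n + 6 ≤ m) (hadj : ∀ v, n ≤ v → v < n + 5 → G.Adj v (v + 1))
    (hL : ∀ v ∈ L, n ≤ v → v < n + 6 → v = z)
    (hrank : ∀ w, n ≤ w → w < n + 6 → ForestRanking G m (insert w F)) :
    ∃ p q r s, CandidateEdge G m F L p q ∧ CandidateEdge G m F L r s ∧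
      p ≠ r ∧ p ≠ s ∧ q ≠ r ∧ q ≠ s := by
  have hedge : ∀ i ≤ 4, z ≠ n + i → z ≠ n + i + 1 → CandidateEdge G m F L (n + i) (n + i + 1) :=
    fun i hi h₁ h₂ =>
    { left_lt := by omega
      right_lt := by omega
      adj := hadj _ (by omega) (by omega)
      left_notMem := fun h => h₁ (hL _ h (by omega) (by omega)).symm
      right_notMem := fun h => h₂ (hL _ h (by omega) (by omega)).symm
      ranking_left := hrank _ (by omega) (by omega)
      ranking_right := hrank _ (by omega) (by omega) }
  by_cases h₁ : z = n ∨ z = n + 1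
  · exact ⟨_, _, _, _, hedge 2 (by omega) (by omega) (by omega),
      hedge 4 (by omega) (by omega) (by omega), by omega, by omega, by omega, by omega⟩
  by_cases h₂ : z = n + 2 ∨ z = n + 3
  · exact ⟨_, _, _, _, hedge 0 (by omega) (by omega) (by omega),
      hedge 4 (by omega) (by omega) (by omega), by omega, by omega, by omega, by omega⟩
  · exact ⟨_, _, _, _, hedge 0 (by omega) (by omega) (by omega),
      hedge 2 (by omega) (by omega) (by omega), by omega, by omega, by omega, by omega⟩

/-- Forcing a deletion at a vertex `y` which is put into the feedback vertex set. -/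
theorem exists_fan (A : OnlineAlgorithm) {κ : ℕ}
    (hA : ∀ G n F, ForestRanking G n F → (A.deleted G n).card ≤ 4 * F.card + κ)
    {G : SimpleGraph ℕ} {n y : ℕ} {F : Finset ℕ} (hy : y < n) (hyF : y ∈ F)
    (hF : ForestRanking G n F) :
    ∃ k, y ∈ A.deleted (attach G n (fanEdges n k y)) (n + k) := by
  refine ⟨2 * (4 * F.card + κ + 1), ?_⟩
  by_contra h
  have h₁ := le_card_deleted_fan A hy h
  have h₂ := hA _ _ _ (hF.fan (k := 2 * (4 * F.card + κ + 1)) hy hyF)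
  omega

/-- Forcing a deletion at one of two vertices, one of which is in the feedback vertex set. -/
theorem exists_commonNeighbor (A : OnlineAlgorithm) {κ : ℕ}
    (hA : ∀ G n F, ForestRanking G n F → (A.deleted G n).card ≤ 4 * F.card + κ)
    {G : SimpleGraph ℕ} {n a b : ℕ} {F : Finset ℕ} (ha : a < n) (hb : b < n) (hab : a ≠ b)
    (haF : a ∈ F) (hF : ForestRanking G n F) :
    ∃ k, a ∈ A.deleted (attach G n (commonNeighborEdges n k a b)) (n + k) ∨
      b ∈ A.deleted (attach G n (commonNeighborEdges n k a b)) (n + k) := by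
  -- All but one of the common neighbours would be deleted, one more than `hA` permits.
  refine ⟨4 * F.card + κ + 2, ?_⟩
  by_contra! h
  have h₁ := le_card_deleted_commonNeighbor A ha hb hab h.1 h.2
  have h₂ := hA _ _ _ (hF.commonNeighbor (k := 4 * F.card + κ + 2) ha hb (Or.inl haF))
  omega

/-- If the new ear at `n, …, n + 5` has at most one deleted vertex, then after `x` and `y` have
been deleted, the adversary continues on this ear. -/
theorem adversaryState_of_ear (A : OnlineAlgorithm) {κ : ℕ}
    (hA : ∀ G n F, ForestRanking G n F → (A.deleted G n).card ≤ 4 * F.card + κ)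
    {G : SimpleGraph ℕ} {n m z y : ℕ} {F L : Finset ℕ}
    (hm : n + 6 ≤ m) (hadj : ∀ v, n ≤ v → v < n + 5 → G.Adj v (v + 1))
    (hLD : L ⊆ A.deleted G m) (hL : ∀ v ∈ L, n ≤ v → v < n + 6 → v = z)
    (hy : y < m) (hyn : n ≤ y → n + 6 ≤ y)
    (hrank : ∀ w, n ≤ w → w < n + 6 → ForestRanking G m (insert w (insert y F))) :
    ∃ m', AdversaryState A m' (insert y F) (insert y L) := by
  obtain ⟨k, hk⟩ := exists_fan A hA hy (by simp) (hrank n le_rfl (by omega))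
  have hag : AgreeBelow m G (attach G m (fanEdges m k y)) := agreeBelow_fan
  obtain ⟨p, q, r, s, h⟩ := exists_two_candidateEdges (G := attach G m (fanEdges m k y))
    (m := m + k) (n := n) (z := z) (F := insert y F) (L := insert y L) (by omega)
    (fun v h₁ h₂ => (hag v (by omega) (v + 1) (by omega)).1 (hadj v h₁ h₂))
    (fun v hv h₁ h₂ => by
      rcases mem_insert.1 hv with rfl | hv
      · omega
      · exact hL v hv h₁ h₂)
    (fun w h₁ h₂ => (hrank w h₁ h₂).fan hy (by simp))
  exact ⟨m + k, _, p, q, r, s, insert_subset hk (hLD.trans (A.deleted_subset hag (by omega))), h⟩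

theorem exists_adversaryState_zero (A : OnlineAlgorithm) :
    ∃ n z, AdversaryState A n ∅ {z} := by
  let G : SimpleGraph ℕ := SimpleGraph.fromRel fun u v => u = 0 ∧ v = 1
  have hG : G.Adj 0 1 := by simp [G]
  have hF : ForestRanking G 2 ∅ := by
    refine ⟨id, fun v hv _ u₁ h₁ _ u₂ h₂ _ a₁ a₂ _ _ => ?_⟩
    have := a₁.ne
    have := a₂.ne
    omega
  obtain ⟨z, hz, -⟩ := exists_mem_deleted_ear (n := 2) A (by omega) (by omega) hG
  obtain ⟨p, q, r, s, h⟩ := exists_two_candidateEdges (F := ∅) (L := {z}) (z := z)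
    (G := attach G 2 (earEdges 2 0 1)) (n := 2) (m := 2 + 6) le_rfl
    (fun v h₁ h₂ => ear_adj_succ h₁ h₂) (fun v hv _ _ => by simpa using hv)
    (fun w h₁ h₂ => hF.ear (by simp) (by omega) (by omega)
      (Or.inr (Or.inr ⟨w, by simp, h₁, h₂⟩)))
  exact ⟨2 + 6, z, _, p, q, r, s, by simpa using hz, h⟩

theorem CandidateEdge.exists_notMem {G : SimpleGraph ℕ} {n z : ℕ} {F L : Finset ℕ} {p q : ℕ}
    (h : CandidateEdge G n F L p q) :
    ∃ x, (x = p ∨ x = q) ∧ x ≠ z ∧ x < n ∧ x ∉ L ∧ ForestRanking G n (insert x F) := by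
  by_cases hp : p = z
  · exact ⟨q, Or.inr rfl, fun hq => h.adj.ne (hp.trans hq.symm), h.right_lt, h.right_notMem,
      h.ranking_right⟩
  · exact ⟨p, Or.inl rfl, hp, h.left_lt, h.left_notMem, h.ranking_left⟩

/-- One round of the adversary costs the algorithm four deletions, the optimum only one. -/
theorem AdversaryState.next {A : OnlineAlgorithm} {κ : ℕ}
    (hA : ∀ G n F, ForestRanking G n F → (A.deleted G n).card ≤ 4 * F.card + κ)
    {n : ℕ} {F L : Finset ℕ} (h : AdversaryState A n F L) :
    ∃ n' F' L', AdversaryState A n' F' L' ∧ F'.card ≤ F.card + 1 ∧ L.card + 4 ≤ L'.card := by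
  obtain ⟨G, p, q, r, s, hLD, hpq, hrs, hpr, hps, hqr, hqs⟩ := h
  have hLn : ∀ v ∈ L, v < n := fun v hv => OnlineAlgorithm.lt_of_mem_deleted (hLD hv)
  obtain ⟨p_lt, q_lt, r_lt, s_lt⟩ := And.intro hpq.left_lt
    (And.intro hpq.right_lt (And.intro hrs.left_lt hrs.right_lt))
  let G₁ := attach G n (earEdges n p q)
  have hG₁ : AgreeBelow n G G₁ := agreeBelow_ear
  let G₂ := attach G₁ (n + 6) (earEdges (n + 6) r s)
  have hG₂ : AgreeBelow (n + 6) G₁ G₂ := agreeBelow_ear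
  obtain ⟨z₁, hz₁, hz₁'⟩ : ∃ z ∈ A.deleted G₁ (n + 6), z = p ∨ z = q ∨ n ≤ z :=
    exists_mem_deleted_ear A hpq.left_lt hpq.right_lt hpq.adj
  obtain ⟨z₂, hz₂, hz₂'⟩ : ∃ z ∈ A.deleted G₂ (n + 6 + 6), z = r ∨ z = s ∨ n + 6 ≤ z :=
    exists_mem_deleted_ear A (by omega) (by omega) ((hG₁ r r_lt s s_lt).1 hrs.adj)
  have hz₁n : z₁ < n + 6 := OnlineAlgorithm.lt_of_mem_deleted hz₁
  -- `x` may already be deleted; being outside `L` and different from `z₁` is enough for it to count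
  -- as a fresh deletion.
  obtain ⟨x, hx, hxz, hxn, hxL, hxF⟩ := hpq.exists_notMem (z := z₁)
  obtain ⟨y, hy, hyz, hyn, hyL, hyF⟩ := hrs.exists_notMem (z := z₂)
  have hxy : x ≠ y := by omega
  have hxz₂ : x ≠ z₂ := by omega
  have hyz₁ : y ≠ z₁ := by omega
  have hz₁L : z₁ ∉ L := by
    rcases hz₁' with rfl | rfl | h
    · exact hpq.left_notMem
    · exact hpq.right_notMem
    · exact fun h' => absurd (hLn _ h') (by omega)
  have hz₂L : z₂ ∉ L := by
    rcases hz₂' with rfl | rfl | h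
    · exact hrs.left_notMem
    · exact hrs.right_notMem
    · exact fun h' => absurd (hLn _ h') (by omega)
  have hz₁₂ : z₁ ≠ z₂ := by omega
  -- `y` breaks the second ear and `w` the first; in `hxrank` the roles are exchanged.
  have hyrank : ∀ w, n ≤ w → w < n + 6 →
      ForestRanking G₂ (n + 6 + 6) (insert w (insert y F)) := fun w h₁ h₂ =>
    (hyF.ear (subset_insert _ _) p_lt q_lt (Or.inr (Or.inr ⟨w, by simp, h₁, h₂⟩))).ear subset_rfl
      (by omega) (by omega) (by rcases hy with rfl | rfl <;> simp)
  have hxrank : ∀ w, n + 6 ≤ w → w < n + 6 + 6 →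
      ForestRanking G₂ (n + 6 + 6) (insert w (insert x F)) := fun w h₁ h₂ =>
    (hxF.ear subset_rfl p_lt q_lt (by rcases hx with rfl | rfl <;> simp)).ear
      (subset_insert _ _) (by omega) (by omega) (Or.inr (Or.inr ⟨w, by simp, h₁, h₂⟩))
  obtain ⟨k, hk⟩ := exists_commonNeighbor A hA (a := y) (b := x) (by omega) (by omega) hxy.symm
    (by simp) (hyrank n le_rfl (by omega))
  let G₃ := attach G₂ (n + 6 + 6) (commonNeighborEdges (n + 6 + 6) k y x)
  have hG₃ : AgreeBelow (n + 6 + 6) G₂ G₃ := agreeBelow_commonNeighbor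
  have hLD₃ : insert z₁ (insert z₂ L) ⊆ A.deleted G₃ (n + 6 + 6 + k) := by
    refine insert_subset ?_ (insert_subset ?_ ?_)
    · exact A.deleted_subset (hG₂.trans (by omega) hG₃) (by omega) hz₁
    · exact A.deleted_subset hG₃ (by omega) hz₂
    · exact hLD.trans
        (A.deleted_subset (hG₁.trans (by omega) (hG₂.trans (by omega) hG₃)) (by omega))
  have hcard : ∀ a b, a ≠ b → (a = x ∨ a = y) → (b = x ∨ b = y) →
      (insert a (insert b (insert z₁ (insert z₂ L)))).card = L.card + 4 := by
    intro a b hab ha hb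
    have haL : a ∉ L := by rcases ha with rfl | rfl <;> assumption
    have hbL : b ∉ L := by rcases hb with rfl | rfl <;> assumption
    rw [card_insert_of_notMem, card_insert_of_notMem, card_insert_of_notMem,
      card_insert_of_notMem hz₂L]
    · simp [hz₁₂, hz₁L]
    · simp only [mem_insert, not_or]
      exact ⟨by omega, by omega, hbL⟩
    · simp only [mem_insert, not_or]
      exact ⟨hab, by omega, by omega, haL⟩
  have hmem : ∀ v a, v ∈ insert a (insert z₁ (insert z₂ L)) → v = a ∨ v = z₁ ∨ v = z₂ ∨ v < n := by
    intro v a hv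
    simp only [mem_insert] at hv
    rcases hv with hv | hv | hv | hv
    · exact Or.inl hv
    · exact Or.inr (Or.inl hv)
    · exact Or.inr (Or.inr (Or.inl hv))
    · exact Or.inr (Or.inr (Or.inr (hLn v hv)))
  rcases hk with hk | hk
  -- The algorithm gave up `y`, so the offline set takes `x` and play continues on the ear at `r`
  -- and `s`.
  · obtain ⟨m', h'⟩ := adversaryState_of_ear A hA (G := G₃) (n := n + 6) (m := n + 6 + 6 + k)
      (z := z₂) (y := x) (F := F) (L := insert y (insert z₁ (insert z₂ L))) (by omega)
      (fun v h₁ h₂ => (hG₃ v (by omega) (v + 1) (by omega)).1 (ear_adj_succ h₁ h₂))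
      (insert_subset hk hLD₃)
      (fun v hv h₁ h₂ => by have := hmem v y hv; omega)
      (by omega) (by omega)
      (fun w h₁ h₂ => (hxrank w h₁ h₂).commonNeighbor (by omega) (by omega) (by simp))
    exact ⟨m', _, _, h', card_insert_le _ _, (hcard x y hxy (by simp) (by simp)).ge⟩
  · obtain ⟨m', h'⟩ := adversaryState_of_ear A hA (G := G₃) (n := n) (m := n + 6 + 6 + k)
      (z := z₁) (y := y) (F := F) (L := insert x (insert z₁ (insert z₂ L))) (by omega)
      (fun v h₁ h₂ => (hG₃ v (by omega) (v + 1) (by omega)).1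
        ((hG₂ v (by omega) (v + 1) (by omega)).1 (ear_adj_succ h₁ h₂)))
      (insert_subset hk hLD₃)
      (fun v hv h₁ h₂ => by have := hmem v x hv; omega)
      (by omega) (by omega)
      (fun w h₁ h₂ => (hyrank w h₁ h₂).commonNeighbor (by omega) (by omega) (by simp))
    exact ⟨m', _, _, h', card_insert_le _ _, (hcard y x hxy.symm (by simp) (by simp)).ge⟩

theorem exists_adversaryState (A : OnlineAlgorithm) {κ : ℕ}
    (hA : ∀ G n F, ForestRanking G n F → (A.deleted G n).card ≤ 4 * F.card + κ) (f : ℕ) :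
    ∃ n F L, AdversaryState A n F L ∧ F.card ≤ f ∧ 4 * f + 1 ≤ L.card := by
  induction f with
  | zero =>
    obtain ⟨n, z, h⟩ := exists_adversaryState_zero A
    exact ⟨n, ∅, {z}, h, by simp, by simp⟩
  | succ f ih =>
    obtain ⟨n, F, L, h, hF, hL⟩ := ih
    obtain ⟨n', F', L', h', hF', hL'⟩ := h.next hA
    exact ⟨n', F', L', h', by omega, by omega⟩

/-! ### The competitive ratio -/

theorem OnlineAlgorithm.not_isCompetitive (A : OnlineAlgorithm) {c : ℝ} (hc : c < 4) :
    ¬ A.IsCompetitive c := by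
  rintro ⟨κ, hκ⟩
  -- A nonnegative ratio is needed to replace the optimum by the upper bound `F.card`.
  obtain ⟨d, hd₀, hd₄, hcd⟩ : ∃ d : ℝ, 0 ≤ d ∧ d < 4 ∧ c ≤ d :=
    ⟨max c 0, le_max_right _ _, max_lt hc (by norm_num), le_max_left _ _⟩
  have hbound : ∀ G n F, ForestRanking G n F →
      ((A.deleted G n).card : ℝ) ≤ d * F.card + κ := by
    intro G n F hF
    rw [A.card_deleted]
    refine (hκ n _).trans (add_le_add_left ?_ κ)
    have : (opt (firstVertices G n) : ℝ) ≤ F.card := by exact_mod_cast hF.opt_le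
    exact (mul_le_mul_of_nonneg_right hcd (Nat.cast_nonneg _)).trans
      (mul_le_mul_of_nonneg_left this hd₀)
  have hA : ∀ G n F, ForestRanking G n F → (A.deleted G n).card ≤ 4 * F.card + ⌈κ⌉₊ := by
    intro G n F hF
    have h₁ := hbound G n F hF
    have h₂ := Nat.le_ceil κ
    have h₃ : d * (F.card : ℝ) ≤ 4 * F.card :=
      mul_le_mul_of_nonneg_right hd₄.le (Nat.cast_nonneg _)
    have : ((A.deleted G n).card : ℝ) ≤ 4 * F.card + ⌈κ⌉₊ := by linarith
    exact_mod_cast this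
  -- Competitiveness would give `4 * f + 1 ≤ d * (f + 1) + κ`, hence `(4 - d) * f ≤ d - 1 + κ < 3 +
  -- κ`.
  obtain ⟨f, hf⟩ := exists_nat_gt ((3 + κ) / (4 - d))
  rw [div_lt_iff₀ (by linarith)] at hf
  obtain ⟨n, F, L, h, hF, hL⟩ := exists_adversaryState A hA f
  obtain ⟨G, p, q, r, s, hLD, hpq, -⟩ := h
  have h₁ := hbound G n _ hpq.ranking_left
  have h₂ : ((insert p F).card : ℝ) ≤ f + 1 := by
    exact_mod_cast (card_insert_le p F).trans (by omega)
  have h₃ : (4 * f + 1 : ℝ) ≤ (A.deleted G n).card := by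
    exact_mod_cast hL.trans (card_le_card hLD)
  have h₄ := mul_le_mul_of_nonneg_left h₂ hd₀
  linarith

end DelayedFVS

theorem mainTheorem2 (ε : ℝ) (hε : 0 < ε) :
    (¬ ∃ A : DelayedFVS.OnlineAlgorithm, A.IsStrictlyCompetitive (4 - ε)) ∧
      (¬ ∃ A : DelayedFVS.OnlineAlgorithm, A.IsCompetitive (4 - ε)) :=
  ⟨fun ⟨A, h⟩ => A.not_isCompetitive (by linarith) h.isCompetitive,
    fun ⟨A, h⟩ => A.not_isCompetitive (by linarith) h⟩
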